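/- Conventions. All locally compact groups are Hausdorff, and $H^{\mathrm{op}}$ denotes $H$ with the same topology and reversed multiplication. For a group $\Gamma$, let $\ell^\infty(\Gamma)$ be the Banach space of bounded functions $\Gamma\to\mathbb{C}$ with the supremum norm, and for $f\in\ell^\infty(\Gamma)$ and $g\in\Gamma$ let $(L_gf)(h):=f(gh)$ $(h\in\Gamma)$. A linear subspace $E\subseteq\ell^\infty(\Gamma)$ is left invariant if $L_gf\in E$ for all $f\in E$ and $g\in\Gamma$. If $E$ is left invariant, $f\in E$ and $\phi\in E^*$, define $$\phi\bullet f\colon \Gamma\to\mathbb{C},\qquad g\mapsto\langle L_gf,\phi\rangle .$$ The subspace $E$ is called left introverted if it is norm closed, left invariant, and $\phi\bullet f\in E$ for all $f\in E$ and all $\phi\in E^*$. For a locally compact group $\Gamma$, let $\mathrm{LUC}(\Gamma)$ be the commutative $C^*$-algebra of all bounded continuous $f\colon\Gamma\to\mathbb{C}$ for which $g\mapsto L_gf$ is norm continuous; it is left invariant. Let $\Gamma_{\mathrm{LUC}}$ be its character space. For locally compact groups $G$ and $H$, let $\mathrm{SC}_0(G\times H)$ be the set of all bounded functions $f\colon G\times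 H\to\mathbb{C}$ such that $f(g,\cdot)\in C_0(H)$ for every $g\in G$ and $f(\cdot,h)\in C_0(G)$ for every $h\in H$, and put $$\mathrm{LUCSC}_0(G\times H^{\mathrm{op}}):=\{f\in\mathrm{LUC}(G\times H^{\mathrm{op}}) : \omega\bullet f\in \mathrm{SC}_0(G\times H)\ \text{for all}\ \omega\in(G\times H^{\mathrm{op}})_{\mathrm{LUC}}\}.$$ Proposition. Let $G$ and $H$ be locally compact groups. Then $\mathrm{LUCSC}_0(G\times H^{\mathrm{op}})$ is left introverted; that is, it is a norm closed, left invariant subspace of $\ell^\infty(G\times H^{\mathrm{op}})$, and $\phi\bullet f\in\mathrm{LUCSC}_0(G\times H^{\mathrm{op}})$ for all $f\in\mathrm{LUCSC}_0(G\times H^{\mathrm{op}})$ and all $\phi\in\mathrm{LUCSC}_0(G\times H^{\mathrm{op}})^*$. -/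

import Mathlib

open Filter Topology

/-- The Banach space (indeed commutative C⋆-algebra) `ℓ^∞(Γ)` of all bounded functions `Γ → ℂ`,
with the supremum norm. -/
abbrev LInfty (Γ : Type*) : Type _ := lp (fun _ : Γ => ℂ) (⊤ : ENNReal)

/-- The left translate `(L_g f)(h) = f (g h)`. -/
def leftTranslate {Γ : Type*} [Group Γ] (g : Γ) (f : LInfty Γ) : LInfty Γ :=
  ⟨fun h => f (g * h), by
    refine memℓp_infty ⟨‖f‖, ?_⟩
    rintro _ ⟨h, rfl⟩
    exact lp.norm_apply_le_norm ENNReal.top_ne_zero f (g * h)⟩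

lemma leftTranslate_mul {Γ : Type*} [Group Γ] (g k : Γ) (f : LInfty Γ) :
    leftTranslate k (leftTranslate g f) = leftTranslate (g * k) f := by
  ext x
  exact congrArg f (mul_assoc g k x).symm

/-- A set (or subspace, subalgebra, ...) `E` of bounded functions is left invariant if
`L_g f ∈ E` for all `f ∈ E` and all `g`. -/
def IsLeftInvariant {Γ S : Type*} [Group Γ] [SetLike S (LInfty Γ)] (E : S) : Prop :=
  ∀ f ∈ E, ∀ g : Γ, leftTranslate g f ∈ E

/-- For a left invariant `E`, a functional `φ` on `E` and `f ∈ E`, the function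
`φ • f : g ↦ ⟨L_g f, φ⟩`. -/
def bullet {Γ S : Type*} [Group Γ] [SetLike S (LInfty Γ)] {E : S} (hE : IsLeftInvariant E)
    (φ : E → ℂ) (f : E) : Γ → ℂ :=
  fun g => φ ⟨leftTranslate g f, hE f f.2 g⟩

/-- A linear subspace `E` of `ℓ^∞(Γ)` is left introverted if it is norm closed and left invariant,
and if `φ • f` belongs to `E` for every `f ∈ E` and every `φ` in the Banach space dual of `E`. -/
def IsLeftIntroverted {Γ : Type*} [Group Γ] (E : Submodule ℂ (LInfty Γ)) : Prop :=
  IsClosed (E : Set (LInfty Γ)) ∧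
    ∃ hE : IsLeftInvariant E,
      ∀ (φ : StrongDual ℂ E) (f : E), ∃ F ∈ E, (F : Γ → ℂ) = bullet hE φ f

section LUC

variable (Γ : Type*) [Group Γ] [TopologicalSpace Γ]

/-- The C⋆-algebra `LUC(Γ)` of the bounded continuous functions `f` on `Γ` for which
`g ↦ L_g f` is norm continuous. -/
def luc : StarSubalgebra ℂ (LInfty Γ) where
  carrier := {f | Continuous (f : Γ → ℂ) ∧ Continuous fun g : Γ => leftTranslate g f}
  mul_mem' ha hb := ⟨ha.1.mul hb.1, ha.2.mul hb.2⟩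
  add_mem' ha hb := ⟨ha.1.add hb.1, ha.2.add hb.2⟩
  algebraMap_mem' r :=
    ⟨continuous_const (y := r), continuous_const (y := algebraMap ℂ (LInfty Γ) r)⟩
  star_mem' ha := ⟨ha.1.star, ha.2.star⟩

variable {Γ}

lemma luc_leftInvariant [ContinuousMul Γ] : IsLeftInvariant (luc Γ) := fun f hf g =>
  ⟨hf.1.comp (continuous_const_mul g), by
    simp only [leftTranslate_mul]
    exact hf.2.comp (continuous_const_mul g)⟩

end LUC

/-- The function `f` on `X × Y` is separately `C₀`: it is bounded, and all its sections
`f(x, ·)` and `f(·, y)` are continuous and vanish at infinity. -/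
def IsSeparatelyC0 {X Y : Type*} [TopologicalSpace X] [TopologicalSpace Y] (f : X × Y → ℂ) :
    Prop :=
  (∃ C : ℝ, ∀ p, ‖f p‖ ≤ C) ∧
    (∀ x, Continuous (fun y => f (x, y)) ∧ Tendsto (fun y => f (x, y)) (cocompact Y) (𝓝 0)) ∧
    ∀ y, Continuous (fun x => f (x, y)) ∧ Tendsto (fun x => f (x, y)) (cocompact X) (𝓝 0)

namespace IsSeparatelyC0

variable {X Y : Type*} [TopologicalSpace X] [TopologicalSpace Y] {f g : X × Y → ℂ}

lemma zero : IsSeparatelyC0 (0 : X × Y → ℂ) :=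
  ⟨⟨0, fun _ => by simp⟩, fun _ => ⟨continuous_const, tendsto_const_nhds⟩,
    fun _ => ⟨continuous_const, tendsto_const_nhds⟩⟩

lemma add (hf : IsSeparatelyC0 f) (hg : IsSeparatelyC0 g) : IsSeparatelyC0 (f + g) := by
  obtain ⟨⟨C, hC⟩, hf1, hf2⟩ := hf
  obtain ⟨⟨D, hD⟩, hg1, hg2⟩ := hg
  exact ⟨⟨C + D, fun p => (norm_add_le _ _).trans (add_le_add (hC p) (hD p))⟩,
    fun x => ⟨(hf1 x).1.add (hg1 x).1, by simpa using (hf1 x).2.add (hg1 x).2⟩,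
    fun y => ⟨(hf2 y).1.add (hg2 y).1, by simpa using (hf2 y).2.add (hg2 y).2⟩⟩

lemma smul (c : ℂ) (hf : IsSeparatelyC0 f) : IsSeparatelyC0 (c • f) := by
  obtain ⟨⟨C, hC⟩, hf1, hf2⟩ := hf
  refine ⟨⟨‖c‖ * C, fun p => ?_⟩,
    fun x => ⟨(hf1 x).1.const_smul c, by simpa using (hf1 x).2.const_smul c⟩,
    fun y => ⟨(hf2 y).1.const_smul c, by simpa using (hf2 y).2.const_smul c⟩⟩
  rw [Pi.smul_apply, norm_smul]
  exact mul_le_mul_of_nonneg_left (hC p) (norm_nonneg c)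

end IsSeparatelyC0

/-- The space `LUCSC₀(G × H^op)`: all `f ∈ LUC(G × H^op)` such that, for every character `ω` of the
C⋆-algebra `LUC(G × H^op)`, the function `ω • f`, regarded as a function on `G × H` (the space
underlying `G × H^op`), is separately `C₀`. -/
def lucsc0 (G H : Type*) [Group G] [TopologicalSpace G] [IsTopologicalGroup G]
    [Group H] [TopologicalSpace H] [IsTopologicalGroup H] :
    Submodule ℂ (LInfty (G × Hᵐᵒᵖ)) where
  carrier := {f | ∃ hf : f ∈ luc (G × Hᵐᵒᵖ),
    ∀ ω : WeakDual.characterSpace ℂ (luc (G × Hᵐᵒᵖ)),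
      IsSeparatelyC0 fun p : G × H =>
        bullet luc_leftInvariant ω ⟨f, hf⟩ (p.1, MulOpposite.op p.2)}
  zero_mem' := by
    refine ⟨zero_mem _, fun ω => ?_⟩
    convert IsSeparatelyC0.zero using 1
    funext p
    exact map_zero ω
  add_mem' := by
    rintro a b ⟨ha, ha'⟩ ⟨hb, hb'⟩
    refine ⟨add_mem ha hb, fun ω => ?_⟩
    convert (ha' ω).add (hb' ω) using 1
    funext p
    exact map_add ω (⟨leftTranslate _ a, luc_leftInvariant a ha _⟩ : luc (G × Hᵐᵒᵖ))
      ⟨leftTranslate _ b, luc_leftInvariant b hb _⟩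
  smul_mem' := by
    rintro c a ⟨ha, ha'⟩
    refine ⟨SMulMemClass.smul_mem c ha, fun ω => ?_⟩
    convert (ha' ω).smul c using 1
    funext p
    exact map_smul ω c (⟨leftTranslate _ a, luc_leftInvariant a ha _⟩ : luc (G × Hᵐᵒᵖ))

/-!
Put `Γ = G × H^op`. The point is that in the definition of `LUCSC₀(Γ)` the characters of `LUC(Γ)`
may be replaced by arbitrary bounded functionals: a function `f ∈ LUC(Γ)` belongs to `LUCSC₀(Γ)` if
and only if the translates `L_{(g, h)} f` tend weakly to `0` as `g → ∞` for fixed `h`, and as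
`h → ∞` for fixed `g` (`mem_lucsc0_iff`). The latter condition is visibly closed and translation
invariant. It passes from `f` to `φ • f`, since `ψ(L_p (φ • f)) = χ(L_p f)` with `χ` a Hahn-Banach
extension of the bounded functional `f' ↦ ψ(φ • f')`.

To pass from characters to a functional `ψ`, identify a commutative C⋆-algebra with `C(K, ℂ)` by
Gelfand duality. The total variation of `ψ` is a positive functional, hence given by a finite
measure `μ`, and `|ψ(a)| ≤ ∫ |a| dμ` (`exists_measure_norm_apply_le_integral`). By dominated
convergence, `ψ(a n) → 0` for a bounded sequence `a` that tends to `0` at every character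
(`tendsto_strongDual_of_tendsto_character`). Dominated convergence needs sequences, while the filter
of neighbourhoods of infinity of a locally compact group need not be countably generated. This
causes no loss, because every subset that is not relatively compact contains a sequence tending to
infinity (`exists_seq_tendsto_cocompact`).
-/

open scoped NNReal CompactlySupported

/-! ### Domination of bounded functionals on `C(K, ℂ)` by measures -/

section Domination

lemma nnreal_iSup_add_iSup_le {ι κ : Type*} [Nonempty ι] [Nonempty κ] {u : ι → ℝ≥0} {v : κ → ℝ≥0}
    {S : ℝ≥0} (h : ∀ i j, u i + v j ≤ S) : (⨆ i, u i) + ⨆ j, v j ≤ S := by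
  have hu : ⨆ i, u i ≤ S :=
    ciSup_le fun i => le_self_add.trans (h i (Classical.arbitrary κ))
  refine add_le_of_le_tsub_left_of_le hu (ciSup_le fun j => le_tsub_of_add_le_left ?_)
  exact add_le_of_le_tsub_right_of_le (le_add_self.trans (h (Classical.arbitrary ι) j))
    (ciSup_le fun i => le_tsub_of_add_le_right (h i j))

variable {K : Type*} [TopologicalSpace K]

/-- The complex continuous functions on `K` whose modulus is dominated by `f`. -/
abbrev DominatedBy (f : C_c(K, ℝ≥0)) : Type _ := {g : C(K, ℂ) // ∀ x, ‖g x‖₊ ≤ f x}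

instance (f : C_c(K, ℝ≥0)) : Nonempty (DominatedBy f) := ⟨⟨0, fun x => by simp⟩⟩

lemma bddAbove_nnnorm_dominatedBy [CompactSpace K] (ψ : StrongDual ℂ C(K, ℂ)) (f : C_c(K, ℝ≥0)) :
    BddAbove (Set.range fun g : DominatedBy f => ‖ψ g.1‖₊) := by
  obtain ⟨C, hC⟩ := (isCompact_range f.continuous).bddAbove
  refine ⟨‖ψ‖₊ * C, ?_⟩
  rintro _ ⟨g, rfl⟩
  refine (ψ.le_opNNNorm g.1).trans (mul_le_mul_right ?_ _)
  exact (ContinuousMap.norm_le (C := (C : ℝ)) g.1 C.2).2 fun x => (g.2 x).trans (hC ⟨x, rfl⟩)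

/-- If `‖g‖ ≤ f₁ + f₂` pointwise, then `g` splits as a sum of continuous functions dominated by
`f₁` and by `f₂`. -/
lemma exists_add_eq_of_dominated (f₁ f₂ : C_c(K, ℝ≥0)) (g : C(K, ℂ))
    (hg : ∀ x, ‖g x‖₊ ≤ f₁ x + f₂ x) :
    ∃ (g₁ : DominatedBy f₁) (g₂ : DominatedBy f₂), g₁.1 + g₂.1 = g := by
  -- The first summand is `g f₁ / (f₁ + f₂)`, which is `0` where the denominator vanishes.
  set r : K → ℝ≥0 := fun x => f₁ x / (f₁ x + f₂ x)
  have hr1 : ∀ x, r x ≤ 1 := fun x => div_le_one_of_le₀ le_self_add zero_le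
  have hcont : Continuous fun x => ((r x : ℝ) : ℂ) * g x := by
    rw [continuous_iff_continuousAt]
    intro x
    by_cases hx : f₁ x + f₂ x = 0
    · have hgx : g x = 0 := by simpa [hx] using hg x
      have h0 : Tendsto g (𝓝 x) (𝓝 0) := hgx ▸ g.continuous.tendsto x
      rw [ContinuousAt, hgx, mul_zero]
      refine squeeze_zero_norm (fun y => ?_) (tendsto_zero_iff_norm_tendsto_zero.1 h0)
      rw [norm_mul, Complex.norm_real, NNReal.norm_eq]
      exact mul_le_of_le_one_left (norm_nonneg _) (hr1 y)
    · have h1 : ContinuousAt r x :=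
        f₁.continuous.continuousAt.div₀
          (f₁.continuous.add f₂.continuous).continuousAt hx
      exact (Complex.continuous_ofReal.continuousAt.comp
        (NNReal.continuous_coe.continuousAt.comp h1)).mul g.continuous.continuousAt
  have key : ∀ x, r x * (f₁ x + f₂ x) = f₁ x := fun x => by
    by_cases hx : f₁ x + f₂ x = 0
    · rw [hx, mul_zero, (add_eq_zero.1 hx).1]
    · exact div_mul_cancel₀ _ hx
  refine ⟨⟨⟨_, hcont⟩, fun x => ?_⟩, ⟨g - ⟨_, hcont⟩, fun x => ?_⟩, add_sub_cancel _ _⟩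
  · have h : ‖((r x : ℝ) : ℂ) * g x‖₊ = r x * ‖g x‖₊ := by
      rw [nnnorm_mul]; congr 1; ext; simp
    change ‖((r x : ℝ) : ℂ) * g x‖₊ ≤ _
    rw [h, ← key x]
    exact mul_le_mul_right (hg x) _
  · have h : ‖g x - ((r x : ℝ) : ℂ) * g x‖ = (1 - r x) * ‖g x‖ := by
      have h' : (1 : ℂ) - ((r x : ℝ) : ℂ) = ((1 - r x : ℝ) : ℂ) := by push_cast; rfl
      rw [← one_sub_mul, norm_mul, h', Complex.norm_real,
        Real.norm_of_nonneg (sub_nonneg.2 (NNReal.coe_le_one.2 (hr1 x)))]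
    change ‖g x - ((r x : ℝ) : ℂ) * g x‖ ≤ (f₂ x : ℝ)
    have hg' : ‖g x‖ ≤ (f₁ x : ℝ) + f₂ x := hg x
    have key' : (r x : ℝ) * (f₁ x + f₂ x) = f₁ x := mod_cast key x
    rw [h]
    calc (1 - (r x : ℝ)) * ‖g x‖ ≤ (1 - r x) * (f₁ x + f₂ x) :=
          mul_le_mul_of_nonneg_left hg' (sub_nonneg.2 (hr1 x))
      _ = f₂ x := by rw [one_sub_mul, key']; ring

/-- The total variation `|ψ|` of a bounded functional `ψ` on `C(K, ℂ)`, as a positive functional: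
`|ψ|(f)` is the supremum of `|ψ(g)|` over all `g` with `|g| ≤ f`. -/
noncomputable def totalVariation [CompactSpace K] (ψ : StrongDual ℂ C(K, ℂ)) :
    C_c(K, ℝ≥0) →ₗ[ℝ≥0] ℝ≥0 where
  toFun f := ⨆ g : DominatedBy f, ‖ψ g.1‖₊
  map_add' f₁ f₂ := by
    apply le_antisymm
    · refine ciSup_le fun g => ?_
      obtain ⟨g₁, g₂, h⟩ := exists_add_eq_of_dominated f₁ f₂ g.1 g.2
      rw [← h, map_add]
      exact (nnnorm_add_le _ _).trans (add_le_add
        (le_ciSup (bddAbove_nnnorm_dominatedBy ψ f₁) g₁)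
        (le_ciSup (bddAbove_nnnorm_dominatedBy ψ f₂) g₂))
    · refine nnreal_iSup_add_iSup_le fun g₁ g₂ => ?_
      -- Rotating `g₁` and `g₂` makes both values of `ψ` nonnegative, so that no cancellation
      -- occurs in the value at the sum.
      obtain ⟨c₁, hc₁, h₁⟩ := Complex.exists_norm_eq_mul_self (ψ g₁.1)
      obtain ⟨c₂, hc₂, h₂⟩ := Complex.exists_norm_eq_mul_self (ψ g₂.1)
      have hc₁' : ‖c₁‖₊ = 1 := NNReal.eq hc₁
      have hc₂' : ‖c₂‖₊ = 1 := NNReal.eq hc₂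
      have hdom : ∀ x, ‖(c₁ • g₁.1 + c₂ • g₂.1) x‖₊ ≤ (f₁ + f₂) x := fun x => by
        refine (nnnorm_add_le _ _).trans (add_le_add ?_ ?_)
        · simpa [nnnorm_mul, hc₁'] using g₁.2 x
        · simpa [nnnorm_mul, hc₂'] using g₂.2 x
      refine le_trans (le_of_eq ?_)
        (le_ciSup (bddAbove_nnnorm_dominatedBy ψ (f₁ + f₂)) ⟨_, hdom⟩)
      ext
      simp only [map_add, map_smul, smul_eq_mul, ← h₁, ← h₂, NNReal.coe_add, coe_nnnorm]
      rw [← Complex.ofReal_add, Complex.norm_real, Real.norm_of_nonneg (by positivity)]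
  map_smul' c f := by
    have hle : ∀ (c : ℝ≥0) (f : C_c(K, ℝ≥0)),
        c * ⨆ g : DominatedBy f, ‖ψ g.1‖₊ ≤ ⨆ g : DominatedBy (c • f), ‖ψ g.1‖₊ := by
      intro c f
      rw [NNReal.mul_iSup]
      refine ciSup_le fun g => ?_
      have hdom : ∀ x, ‖(((c : ℝ) : ℂ) • g.1) x‖₊ ≤ (c • f) x := fun x => by
        have := mul_le_mul_right (g.2 x) c
        simpa [nnnorm_mul] using this
      refine le_trans (le_of_eq ?_)
        (le_ciSup (bddAbove_nnnorm_dominatedBy ψ (c • f)) ⟨_, hdom⟩)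
      simp [nnnorm_mul]
    refine le_antisymm ?_ (hle c f)
    rcases eq_or_ne c 0 with rfl | hc
    · refine ciSup_le fun g => ?_
      have : g.1 = 0 := by
        ext x
        simpa using g.2 x
      simp [this]
    · have := hle c⁻¹ (c • f)
      rw [smul_smul, inv_mul_cancel₀ hc, one_smul] at this
      rwa [inv_mul_le_iff₀ (pos_iff_ne_zero.2 hc)] at this

/-- Every bounded functional on `C(K, ℂ)` is dominated by the integral against a finite measure,
namely the one representing its total variation. -/
lemma exists_measure_norm_apply_le_integral [CompactSpace K] [T2Space K] [MeasurableSpace K]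
    [BorelSpace K] (ψ : StrongDual ℂ C(K, ℂ)) :
    ∃ μ : MeasureTheory.Measure K, MeasureTheory.IsFiniteMeasure μ ∧
      ∀ g : C(K, ℂ), ‖ψ g‖ ≤ ∫ x, ‖g x‖ ∂μ := by
  refine ⟨NNRealRMK.rieszMeasure (totalVariation ψ), inferInstance, fun g => ?_⟩
  let f : C_c(K, ℝ≥0) := CompactlySupportedContinuousMap.continuousMapEquiv
    ⟨fun x => ‖g x‖₊, by fun_prop⟩
  have h : ‖ψ g‖₊ ≤ totalVariation ψ f :=
    le_ciSup (bddAbove_nnnorm_dominatedBy ψ f) ⟨g, fun x => le_rfl⟩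
  have := NNRealRMK.integral_rieszMeasure (totalVariation ψ) f
  calc ‖ψ g‖ ≤ totalVariation ψ f := h
    _ = _ := this.symm

end Domination

/-! ### Weak convergence tested on characters -/

/-- In a commutative unital C⋆-algebra, a bounded sequence which is annihilated in the limit by
every character is weakly null: this is dominated convergence on the character space. -/
lemma tendsto_strongDual_of_tendsto_character {A : Type*} [CommCStarAlgebra A]
    (ψ : StrongDual ℂ A) {a : ℕ → A} {C : ℝ} (hC : ∀ n, ‖a n‖ ≤ C)
    (h : ∀ ω : WeakDual.characterSpace ℂ A, Tendsto (fun n => ω (a n)) atTop (𝓝 0)) :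
    Tendsto (fun n => ψ (a n)) atTop (𝓝 0) := by
  let K := ↥(WeakDual.characterSpace ℂ A)
  borelize K
  have hiso := gelfandTransform_isometry A
  let e : A ≃⋆ₐ[ℂ] C(K, ℂ) := gelfandStarTransform A
  have hnorm : ∀ x, ‖e x‖ = ‖x‖ := fun x => hiso.norm_map_of_map_zero (map_zero _) x
  let Ψ : StrongDual ℂ C(K, ℂ) :=
    LinearMap.mkContinuous (ψ.toLinearMap ∘ₗ (e.symm : C(K, ℂ) →ₗ[ℂ] A)) ‖ψ‖ fun g => by
      refine (ψ.le_opNorm (e.symm g)).trans_eq ?_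
      rw [← hnorm, StarAlgEquiv.apply_symm_apply]
  have hΨ : ∀ x, Ψ (e x) = ψ x := fun x => congrArg ψ (e.symm_apply_apply x)
  obtain ⟨μ, hμ, hle⟩ := exists_measure_norm_apply_le_integral Ψ
  have hint : Tendsto (fun n => ∫ ω, ‖e (a n) ω‖ ∂μ) atTop (𝓝 (∫ _, (0 : ℝ) ∂μ)) := by
    refine MeasureTheory.tendsto_integral_of_dominated_convergence (fun _ => C)
      (fun n => (e (a n)).continuous.norm.aestronglyMeasurable) (MeasureTheory.integrable_const C)
      (fun n => .of_forall fun ω => ?_) (.of_forall fun ω => ?_)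
    · rw [norm_norm]
      exact ((e (a n)).norm_coe_le_norm ω).trans ((hnorm _).trans_le (hC n))
    · exact tendsto_zero_iff_norm_tendsto_zero.1 (h ω)
  rw [MeasureTheory.integral_zero] at hint
  exact squeeze_zero_norm (fun n => hΨ (a n) ▸ hle (e (a n))) hint

open scoped Pointwise in
/-- A subset of a locally compact group that is not relatively compact contains a sequence
tending to infinity, although the filter `cocompact G` need not be countably generated. -/
lemma exists_seq_tendsto_cocompact {G : Type*} [Group G] [TopologicalSpace G]
    [IsTopologicalGroup G] [LocallyCompactSpace G] {p : G → Prop}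
    (hp : ∃ᶠ g in cocompact G, p g) :
    ∃ u : ℕ → G, (∀ n, p (u n)) ∧ Tendsto u atTop (cocompact G) := by
  obtain ⟨V, hV, hV1⟩ := exists_compact_mem_nhds (1 : G)
  have hex : ∀ K : Set G, IsCompact K → ∃ g, p g ∧ g ∉ K := fun K hK =>
    (hp.and_eventually hK.compl_mem_cocompact).exists
  choose! next hnext hnext' using hex
  -- Choose compact sets `K n` with `(K n ∪ {u n}) * V ⊆ K (n + 1)`, where
  -- `u n = next (K n)` satisfies `p` and lies outside `K n`. Their union is then closed and
  -- covered by their interiors, so that a compact set meets it inside a single `K n`.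
  let K : ℕ → Set G := fun n => n.rec ∅ fun _ L => insert (next L) L * V
  have hKs : ∀ n, K (n + 1) = insert (next (K n)) (K n) * V := fun n => rfl
  have hK : ∀ n, IsCompact (K n) := fun n => by
    induction n with
    | zero => exact isCompact_empty
    | succ n ih => exact (ih.insert _).mul hV
  have hmul : ∀ n, ∀ x ∈ insert (next (K n)) (K n), K (n + 1) ∈ 𝓝 x := fun n x hx => by
    have : (fun y => x * y) '' V ∈ 𝓝 (x * 1) := (Homeomorph.mulLeft x).isOpenMap.image_mem_nhds hV1
    rw [mul_one] at this
    refine mem_of_superset this ?_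
    rintro _ ⟨v, hv, rfl⟩
    exact Set.mul_mem_mul hx hv
  have hmono : Monotone K := monotone_nat_of_le_succ fun n x hx =>
    mem_of_mem_nhds (hmul n x (Set.mem_insert_of_mem _ hx))
  refine ⟨fun n => next (K n), fun n => hnext _ (hK n), ?_⟩
  have hclosed : IsClosed (⋃ n, K n) := by
    refine isClosed_iff_clusterPt.2 fun x hx => ?_
    have hW : {y | y⁻¹ * x ∈ V} ∈ 𝓝 x := by
      have hc : ContinuousAt (fun y : G => y⁻¹ * x) x := by fun_prop
      exact hc (by simpa using hV1)
    obtain ⟨y, hy, hy'⟩ := (clusterPt_iff_nonempty.1 hx) hW (mem_principal_self _)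
    obtain ⟨n, hn⟩ := Set.mem_iUnion.1 hy'
    refine Set.mem_iUnion.2 ⟨n + 1, ?_⟩
    rw [hKs]
    exact ⟨y, Set.mem_insert_of_mem _ hn, y⁻¹ * x, hy, mul_inv_cancel_left _ _⟩
  refine tendsto_def.2 fun s hs => ?_
  obtain ⟨L, hL, hLs⟩ := mem_cocompact.1 hs
  obtain ⟨N, hN⟩ := (hL.inter_right hclosed).elim_directed_cover (fun n => interior (K n))
    (fun _ => isOpen_interior) (fun x hx => by
      obtain ⟨n, hn⟩ := Set.mem_iUnion.1 hx.2
      exact Set.mem_iUnion.2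
        ⟨n + 1, mem_interior_iff_mem_nhds.2 (hmul n x (Set.mem_insert_of_mem _ hn))⟩)
    (directed_of_isDirected_le fun i j hij => interior_mono (hmono hij))
  refine mem_atTop_sets.2 ⟨N, fun n hn => hLs fun hmem => ?_⟩
  refine hnext' _ (hK n) (hmono hn (interior_subset (hN ⟨hmem, Set.mem_iUnion.2 ⟨n + 1, ?_⟩⟩)))
  exact mem_of_mem_nhds (hmul n _ (Set.mem_insert _ _))

/-- Over a locally compact group, weak convergence to `0` at infinity of a bounded family in a
commutative C⋆-algebra can be tested on characters. -/
lemma tendsto_cocompact_strongDual {A X : Type*} [CommCStarAlgebra A] [Group X]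
    [TopologicalSpace X] [IsTopologicalGroup X] [LocallyCompactSpace X] (ψ : StrongDual ℂ A)
    {a : X → A} {C : ℝ} (hC : ∀ x, ‖a x‖ ≤ C)
    (h : ∀ ω : WeakDual.characterSpace ℂ A, Tendsto (fun x => ω (a x)) (cocompact X) (𝓝 0)) :
    Tendsto (fun x => ψ (a x)) (cocompact X) (𝓝 0) := by
  by_contra hcon
  obtain ⟨s, hs, hfreq⟩ := not_tendsto_iff_exists_frequently_notMem.1 hcon
  obtain ⟨u, hu, hutends⟩ := exists_seq_tendsto_cocompact hfreq
  have hlim := tendsto_strongDual_of_tendsto_character ψ (fun n => hC (u n))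
    fun ω => (h ω).comp hutends
  obtain ⟨n, hn⟩ := (hlim.eventually hs).exists
  exact hu n hn

/-! ### Translations, `LUC(Γ)` and the operators `f ↦ φ • f` -/

section Translation

variable {Γ : Type*} [Group Γ]

lemma norm_leftTranslate_le (g : Γ) (f : LInfty Γ) : ‖leftTranslate g f‖ ≤ ‖f‖ :=
  lp.norm_le_of_forall_le (norm_nonneg f) fun h =>
    lp.norm_apply_le_norm ENNReal.top_ne_zero f (g * h)

lemma dist_leftTranslate_le (g : Γ) (f f' : LInfty Γ) :
    dist (leftTranslate g f) (leftTranslate g f') ≤ dist f f' := by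
  rw [dist_eq_norm, dist_eq_norm]
  exact norm_leftTranslate_le g (f - f')

/-- For `φ` in the dual of a left invariant subspace `E`, the operator `f ↦ φ • f` from `E` to
`ℓ^∞(Γ)`. -/
noncomputable def bulletCLM {E : Submodule ℂ (LInfty Γ)} (hE : IsLeftInvariant E)
    (φ : StrongDual ℂ E) : E →L[ℂ] LInfty Γ :=
  have hbound : ∀ (f : E) (g : Γ), ‖bullet hE φ f g‖ ≤ ‖φ‖ * ‖f‖ := fun f g =>
    φ.le_opNorm_of_le (norm_leftTranslate_le g f)
  LinearMap.mkContinuous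
    { toFun := fun f => ⟨bullet hE φ f, memℓp_infty ⟨‖φ‖ * ‖f‖, by
        rintro _ ⟨g, rfl⟩
        exact hbound f g⟩⟩
      map_add' := fun f f' => by
        ext g
        exact map_add φ ⟨leftTranslate g f, hE f f.2 g⟩ ⟨leftTranslate g f', hE f' f'.2 g⟩
      map_smul' := fun c f => by
        ext g
        exact map_smul φ c ⟨leftTranslate g f, hE f f.2 g⟩ } ‖φ‖
    fun f => lp.norm_le_of_forall_le (by positivity) (hbound f)

lemma leftTranslate_bulletCLM {E : Submodule ℂ (LInfty Γ)} (hE : IsLeftInvariant E)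
    (φ : StrongDual ℂ E) (f : E) (k : Γ) :
    leftTranslate k (bulletCLM hE φ f) = bulletCLM hE φ ⟨leftTranslate k f, hE f f.2 k⟩ := by
  ext g
  exact congrArg φ (Subtype.ext (leftTranslate_mul k g f).symm)

lemma isClosed_tendsto_strongDual_leftTranslate {X : Type*} (l : Filter X) (q : X → Γ)
    (ψ : StrongDual ℂ (LInfty Γ)) :
    IsClosed {f | Tendsto (fun x => ψ (leftTranslate (q x) f)) l (𝓝 0)} := by
  refine Equicontinuous.isClosed_setOfPred_tendsto ?_ continuous_const
  refine (LipschitzWith.uniformEquicontinuous _ ‖ψ‖₊ fun x => ?_).equicontinuous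
  refine LipschitzWith.of_dist_le_mul fun f f' => (ψ.lipschitz.dist_le_mul _ _).trans ?_
  exact mul_le_mul_of_nonneg_left (dist_leftTranslate_le _ _ _) (NNReal.coe_nonneg _)

variable [TopologicalSpace Γ]

/-- Norm continuity of translation already implies continuity, by evaluation at `1`. -/
lemma mem_luc_iff {f : LInfty Γ} : f ∈ luc Γ ↔ Continuous fun g : Γ => leftTranslate g f := by
  refine ⟨And.right, fun h => ⟨?_, h⟩⟩
  have heval : LipschitzWith 1 fun F : LInfty Γ => F 1 :=
      LipschitzWith.of_dist_le_mul fun F F' => by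
    rw [NNReal.coe_one, one_mul, dist_eq_norm, dist_eq_norm]
    exact lp.norm_apply_le_norm ENNReal.top_ne_zero (F - F') 1
  have : (fun g : Γ => leftTranslate g f 1) = f := funext fun g => congrArg f (mul_one g)
  exact this ▸ heval.continuous.comp h

lemma isClosed_luc : IsClosed (luc Γ : Set (LInfty Γ)) := by
  refine isClosed_of_closure_subset fun f hf => mem_luc_iff.2 ?_
  refine continuous_of_uniform_approx_of_continuous fun u hu => ?_
  obtain ⟨ε, hε, hεu⟩ := Metric.mem_uniformity_dist.1 hu
  obtain ⟨f', hf', hd⟩ := Metric.mem_closure_iff.1 hf ε hε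
  exact ⟨_, mem_luc_iff.1 hf', fun g => hεu ((dist_leftTranslate_le g f f').trans_lt hd)⟩

/-- The restriction to `LUC(Γ)` of a character of `ℓ^∞(Γ)`. -/
noncomputable def lucCharacter (ω : WeakDual.characterSpace ℂ (LInfty Γ)) :
    WeakDual.characterSpace ℂ (luc Γ) :=
  ⟨StrongDual.toWeakDual ((WeakDual.toStrongDual ω.1).comp
      (luc Γ).toSubalgebra.toSubmodule.subtypeL), by
    refine ⟨fun h => one_ne_zero (α := ℂ) ?_, fun x y => map_mul ω (x : LInfty Γ) y⟩
    rw [← map_one ω]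
    exact DFunLike.congr_fun h (1 : luc Γ)⟩

lemma bulletCLM_mem_luc {E : Submodule ℂ (LInfty Γ)} (hE : IsLeftInvariant E)
    (φ : StrongDual ℂ E) {f : E} (hf : (f : LInfty Γ) ∈ luc Γ) : bulletCLM hE φ f ∈ luc Γ := by
  rw [mem_luc_iff]
  simp only [leftTranslate_bulletCLM]
  exact (bulletCLM hE φ).continuous.comp ((mem_luc_iff.1 hf).subtype_mk _)

end Translation

/-! ### Weak vanishing at infinity in each variable -/

section WeaklyVanishing

variable {G H : Type*} [Group G] [TopologicalSpace G] [Group H] [TopologicalSpace H]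

/-- A bounded function `f` is weakly vanishing if its translates `L_{(g, h)} f`, as elements of the
Banach space `ℓ^∞(G × H^op)`, tend weakly to `0` at infinity in each of the two variables. Weak
convergence is tested on the whole dual of `ℓ^∞`, so that no subspace enters the definition. -/
def WeaklyVanishing (f : LInfty (G × Hᵐᵒᵖ)) : Prop :=
  ∀ ψ : StrongDual ℂ (LInfty (G × Hᵐᵒᵖ)),
    (∀ g : G, Tendsto (fun h : H => ψ (leftTranslate (g, MulOpposite.op h) f)) (cocompact H)
      (𝓝 0)) ∧
    ∀ h : H, Tendsto (fun g : G => ψ (leftTranslate (g, MulOpposite.op h) f)) (cocompact G) (𝓝 0)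

/-- Membership in `LUCSC₀(G × H^op)` can be tested on all bounded functionals instead of on
characters of `LUC(G × H^op)`. -/
lemma mem_lucsc0_iff [IsTopologicalGroup G] [LocallyCompactSpace G]
    [IsTopologicalGroup H] [LocallyCompactSpace H]
    {f : LInfty (G × Hᵐᵒᵖ)} :
    f ∈ lucsc0 G H ↔ f ∈ luc (G × Hᵐᵒᵖ) ∧ WeaklyVanishing f := by
  constructor
  · rintro ⟨hf, h⟩
    -- Testing on characters of `ℓ^∞` suffices, and these restrict to characters of `LUC`.
    exact ⟨hf, fun ψ =>
      ⟨fun g => tendsto_cocompact_strongDual ψ (fun _ => norm_leftTranslate_le _ f)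
        fun ω => ((h (lucCharacter ω)).2.1 g).2,
      fun k => tendsto_cocompact_strongDual ψ (fun _ => norm_leftTranslate_le _ f)
        fun ω => ((h (lucCharacter ω)).2.2 k).2⟩⟩
  · rintro ⟨hf, h⟩
    refine ⟨hf, fun ω => ?_⟩
    obtain ⟨ψ, hψ, -⟩ := exists_extension_norm_eq (luc (G × Hᵐᵒᵖ)).toSubalgebra.toSubmodule
      (WeakDual.toStrongDual ω.1)
    have heq : ∀ p, bullet luc_leftInvariant ω ⟨f, hf⟩ p = ψ (leftTranslate p f) := fun p =>
      (hψ ⟨leftTranslate p f, luc_leftInvariant f hf p⟩).symm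
    have hcont := ψ.continuous.comp (mem_luc_iff.1 hf)
    simp only [heq]
    exact ⟨⟨‖ψ‖ * ‖f‖, fun p => ψ.le_opNorm_of_le (norm_leftTranslate_le _ f)⟩,
      fun g => ⟨hcont.comp (by fun_prop : Continuous fun k : H => (g, MulOpposite.op k)),
        (h ψ).1 g⟩,
      fun k => ⟨hcont.comp (by fun_prop : Continuous fun g : G => (g, MulOpposite.op k)),
        (h ψ).2 k⟩⟩

lemma isClosed_weaklyVanishing :
    IsClosed {f : LInfty (G × Hᵐᵒᵖ) | WeaklyVanishing f} := by
  simp only [WeaklyVanishing, Set.ofPred_forall, Set.ofPred_and]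
  exact isClosed_iInter fun ψ =>
    (isClosed_iInter fun g => isClosed_tendsto_strongDual_leftTranslate _ _ ψ).inter
      (isClosed_iInter fun h => isClosed_tendsto_strongDual_leftTranslate _ _ ψ)

lemma WeaklyVanishing.translate [IsTopologicalGroup G] [IsTopologicalGroup H]
    {f : LInfty (G × Hᵐᵒᵖ)} (hf : WeaklyVanishing f)
    (k : G × Hᵐᵒᵖ) : WeaklyVanishing (leftTranslate k f) := by
  intro ψ
  simp only [leftTranslate_mul]
  -- In the opposite group, left translation by `k` is right translation in the second variable.
  exact ⟨fun g => ((hf ψ).1 (k.1 * g)).comp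
      (Homeomorph.mulRight k.2.unop).isClosedEmbedding.tendsto_cocompact,
    fun h => ((hf ψ).2 (h * k.2.unop)).comp
      (Homeomorph.mulLeft k.1).isClosedEmbedding.tendsto_cocompact⟩

/-- Weak vanishing passes from `f` to `φ • f`, because `ψ(L_p (φ • f))` is the value at `L_p f` of
the bounded functional `f' ↦ ψ(φ • f')`. -/
lemma WeaklyVanishing.bullet {E : Submodule ℂ (LInfty (G × Hᵐᵒᵖ))} (hE : IsLeftInvariant E)
    (φ : StrongDual ℂ E) {f : E} (hf : WeaklyVanishing (f : LInfty (G × Hᵐᵒᵖ))) :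
    WeaklyVanishing (bulletCLM hE φ f) := by
  intro ψ
  obtain ⟨χ, hχ, -⟩ := exists_extension_norm_eq E (ψ.comp (bulletCLM hE φ))
  have heq : ∀ p, ψ (leftTranslate p (bulletCLM hE φ f)) =
      χ (leftTranslate p f) := fun p => by
    rw [leftTranslate_bulletCLM]
    exact (hχ ⟨leftTranslate p f, hE f f.2 p⟩).symm
  simp only [heq]
  exact hf χ

end WeaklyVanishing

theorem proposition4p2 (G H : Type*)
    [Group G] [TopologicalSpace G] [IsTopologicalGroup G] [LocallyCompactSpace G] [T2Space G]
    [Group H] [TopologicalSpace H] [IsTopologicalGroup H] [LocallyCompactSpace H] [T2Space H] :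
    IsLeftIntroverted (lucsc0 G H) := by
  have hset : (lucsc0 G H : Set (LInfty (G × Hᵐᵒᵖ))) =
      (luc (G × Hᵐᵒᵖ) : Set _) ∩ {f | WeaklyVanishing f} := Set.ext fun _ => mem_lucsc0_iff
  have hE : IsLeftInvariant (lucsc0 G H) := fun f hf k => by
    rw [mem_lucsc0_iff] at hf ⊢
    exact ⟨luc_leftInvariant f hf.1 k, hf.2.translate k⟩
  refine ⟨hset ▸ isClosed_luc.inter isClosed_weaklyVanishing, hE, fun φ f => ?_⟩
  obtain ⟨hf, hf'⟩ := mem_lucsc0_iff.1 f.2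
  exact ⟨bulletCLM hE φ f, mem_lucsc0_iff.2 ⟨bulletCLM_mem_luc hE φ hf, hf'.bullet hE φ⟩, rfl⟩
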